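/- Let $d\ge 3$ and let $\langle Q,+,\cdot,\le\rangle$ be an ordered field (axiom AxOField). Write coordinate points as $\bar x=\langle x_1,\dots,x_d\rangle\in Q^d$, where $x_1$ is the time coordinate, and put $\mathsf{time}(\bar x,\bar y)=x_1-y_1$, $\mathsf{space}^2(\bar x,\bar y)=\sum_{i=2}^d(x_i-y_i)^2$, $\bar o=\langle 0,\dots,0\rangle$, $\bar 1_t=\langle 1,0,\dots,0\rangle$. Let $B$ be a set of bodies, some of which are inertial observers and some of which are light signals, and let $W\subseteq B\times B\times Q^d$ be a relation; $W(m,b,\bar x)$ is read "$m$ coordinatizes the body $b$ at $\bar x$". Write $\mathrm{ev}_m(\bar x)=\{b\in B: W(m,b,\bar x)\}$ for the event occurring for $m$ at $\bar x$, and let $\mathsf{w}_{mk}$ be the binary relation on $Q^d$ that relates $\bar x$ to $\bar y$ iff $\mathrm{ev}_m(\bar x)=\mathrm{ev}_k(\bar y)\ne\emptyset$. Assume: - (AxPh) for every inertial observer $m$ there is $c_m>0$ in $Q$ such that for all $\bar x,\bar y\in Q^d$ there is a light signal $p$ with $W(m,p,\bar x)$ and $W(m,p,\bar y)$ if and only if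 $\mathsf{space}^2(\bar x,\bar y)=c_m^2\cdot\mathsf{time}(\bar x,\bar y)^2$; - (AxEv) for all inertial observers $m,k$ and every $\bar x\in Q^d$ there is $\bar y\in Q^d$ with $\mathrm{ev}_m(\bar x)=\mathrm{ev}_k(\bar y)$. (Under these axioms $\mathsf{w}_{mk}$ is the graph of a bijection of $Q^d$ whenever $m$ and $k$ are inertial observers.) Let $m$ and $k$ be inertial observers. For an inertial observer $h$, events $\mathrm{ev}_m(\bar x)$ and $\mathrm{ev}_m(\bar y)$ are called simultaneous for $h$ if $x'_1=y'_1$ for all $\bar x',\bar y'\in Q^d$ with $\mathrm{ev}_m(\bar x)=\mathrm{ev}_h(\bar x')$ and $\mathrm{ev}_m(\bar y)=\mathrm{ev}_h(\bar y')$. They are called separated orthogonally to the plane of motion of $k$ according to $m$ if $x_1=y_1$ and $\sum_{i=1}^d (x_i-y_i)\,u_i=0$, where $\bar u=\mathsf{w}_{km}(\bar 1_t)-\mathsf{w}_{km}(\bar o)$. Then for all $\bar x,\bar y\in Q^d$, the events $\mathrm{ev}_m(\bar x)$ and $\mathrm{ev}_m(\bar y)$ are simultaneous for both $m$ and $k$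 if and only if they are separated orthogonally to the plane of motion of $k$ according to $m$. In particular, if moreover every inertial observer $h$ is stationary relative to itself (AxSelf: $W(h,h,\bar x)$ iff $x_2=\dots=x_d=0$) and the squared speed of $k$ according to $m$ is $0$, that is, there are $\bar x\ne\bar y$ with $W(m,k,\bar x)$, $W(m,k,\bar y)$ and $\mathsf{space}^2(\bar x,\bar y)=0$, then for all $\bar x,\bar y\in Q^d$ the events $\mathrm{ev}_m(\bar x)$ and $\mathrm{ev}_m(\bar y)$ are simultaneous for $m$ if and only if they are simultaneous for $k$. -/

import Mathlib

/-- A model of the two-sorted language of observers, light signals and coordinates over a set `B`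
of bodies and a set `Q` of quantities, in spacetime dimension `d`.  `W m b x` says that `m`
coordinatizes the body `b` at the coordinate point `x`. -/
structure WorldviewModel (B Q : Type*) (d : ℕ) where
  /-- `Ob b`: the body `b` is an observer. -/
  Ob : B → Prop
  /-- `IOb b`: the body `b` is an inertial observer. -/
  IOb : B → Prop
  /-- `Ph b`: the body `b` is a light signal. -/
  Ph : B → Prop
  /-- The worldview relation. -/
  W : B → B → (Fin d → Q) → Prop

namespace WorldviewModel

section coordinates

variable {Q : Type*} [Field Q] {d : ℕ} [NeZero d]

/-- Time difference of two coordinate points; coordinate `0` is the time coordinate. -/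
def time (x y : Fin d → Q) : Q := x 0 - y 0

/-- Squared spatial distance of two coordinate points. -/
def spaceSq (x y : Fin d → Q) : Q := ∑ i ∈ Finset.univ.erase (0 : Fin d), (x i - y i) ^ 2

/-- The time unit vector `⟨1, 0, …, 0⟩`. -/
def timeUnit : Fin d → Q := Pi.single 0 1

/-- Orthogonality in the Euclidean sense: `x₁ y₁ + … + x_d y_d = 0`. -/
def EuclOrthogonal (x y : Fin d → Q) : Prop := ∑ i, x i * y i = 0

end coordinates

variable {B Q : Type*} {d : ℕ} (M : WorldviewModel B Q d)

/-- The event occurring for `m` at `x`: the set of bodies that `m` coordinatizes at `x`. -/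
def ev (m : B) (x : Fin d → Q) : Set B := {b | M.W m b x}

/-- The worldview transformation, as a binary relation: it connects the coordinate points at which
`m` and `k` coordinatize the same nonempty event. -/
def worldview (m k : B) (x y : Fin d → Q) : Prop := M.ev m x = M.ev k y ∧ (M.ev m x).Nonempty

/-- All inertial observers coordinatize the same set of events. -/
def AxEv : Prop :=
  ∀ m k : B, M.IOb m → M.IOb k → ∀ x : Fin d → Q, ∃ y : Fin d → Q, ∀ b, M.W m b x ↔ M.W k b y

/-- Two events are simultaneous for `k` if their time coordinates agree wherever `k`
coordinatizes them. -/
def Simultaneous [NeZero d] (k : B) (e f : Set B) : Prop :=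
  ∀ x' y' : Fin d → Q, e = M.ev k x' → f = M.ev k y' → x' 0 = y' 0

variable [Field Q] [NeZero d]

/-- For every inertial observer, the speed of light is the same positive quantity everywhere and in
every direction, and light signals can be sent out everywhere in every direction. -/
def AxPh [LinearOrder Q] : Prop :=
  ∀ m : B, M.IOb m → ∃ c : Q, 0 < c ∧ ∀ x y : Fin d → Q,
    (∃ p, M.Ph p ∧ M.W m p x ∧ M.W m p y) ↔ spaceSq x y = c ^ 2 * time x y ^ 2

/-- Every inertial observer is stationary relative to himself. -/
def AxSelf : Prop :=
  ∀ m : B, M.IOb m → ∀ x : Fin d → Q, M.W m m x ↔ ∀ i, i ≠ 0 → x i = 0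

/-- `v` is a squared speed of `k` according to `m`. -/
def SpeedSq (m k : B) (v : Q) : Prop :=
  ∃ x y : Fin d → Q, x ≠ y ∧ M.W m k x ∧ M.W m k y ∧ spaceSq x y = v * time x y ^ 2

/-- The events at `x` and `y` are separated orthogonally to the plane of motion of `k` according
to `m`: `x` and `y` have the same time coordinate and `x - y` is orthogonal, in the Euclidean sense,
to `p - q`, where `p` and `q` are the values at the time unit vector and at the origin of the
worldview transformation from `k` to `m`. -/
def SeparatedOrthogonally (m k : B) (x y : Fin d → Q) : Prop :=
  x 0 = y 0 ∧ ∃ p q : Fin d → Q, M.worldview k m timeUnit p ∧ M.worldview k m 0 q ∧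
    EuclOrthogonal (x - y) (p - q)

end WorldviewModel

/-!
Light signals make the worldview transformation from `k` to `m` a bijection of `Q ^ d` that
preserves null separation for the Minkowski forms of the two observers.  Such a bijection `f` is a
semilinear similarity up to a translation.  It maps null lines onto null lines, and it preserves
orthogonality to null directions, because a line with null direction `n` through `x` contains
exactly one point null separated from `z` if and only if `x - z` is not orthogonal to `n`.  Hence
parallel null lines go to parallel null lines, which makes `f` additive up to a translation; the
parameters of all null lines are then transformed by one and the same map, a field homomorphism.

Consequently two events are simultaneous for `k` if and only if, according to `m`, their difference
is Minkowski orthogonal to the image of the time unit vector of `k`; for differences without a time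
component this is Euclidean orthogonality.
-/

section Lorentzian

variable {K V : Type*} [Field K] [AddCommGroup V] [Module K V]

/-- Lorentzian forms over an arbitrary field: nondegenerate symmetric bilinear forms of Witt index
one in dimension at least three.  Without an order on `K` the signature is not available, and
`collinear` (two orthogonal null vectors are proportional) takes its place. -/
structure IsLorentzian (B : LinearMap.BilinForm K V) : Prop where
  isSymm : B.IsSymm
  nondegenerate : B.Nondegenerate
  two_lt_finrank : 2 < Module.finrank K V
  exists_null : ∃ n, n ≠ 0 ∧ B n n = 0
  collinear : ∀ n v, n ≠ 0 → B n n = 0 → B v v = 0 → B v n = 0 → ∃ a : K, v = a • n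

namespace IsLorentzian

variable {B : LinearMap.BilinForm K V}

theorem comm (hB : IsLorentzian B) (u v : V) : B u v = B v u := hB.isSymm.eq u v

theorem apply_add_self (hB : IsLorentzian B) (u v : V) :
    B (u + v) (u + v) = B u u + 2 * B u v + B v v := by
  simp only [map_add, LinearMap.add_apply, hB.comm v u]
  ring

theorem apply_add_smul_self (hB : IsLorentzian B) {n : V} (hn : B n n = 0) (u : V) (a : K) :
    B (u + a • n) (u + a • n) = B u u + 2 * a * B u n := by
  simp only [hB.apply_add_self, map_smul, LinearMap.smul_apply, smul_eq_mul, hn]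
  ring

theorem exists_orthogonal_not_null (hB : IsLorentzian B) {n m : V} (hn : B n n = 0)
    (hmn : B m n ≠ 0) : ∃ w, B w n = 0 ∧ B w m = 0 ∧ B w w ≠ 0 := by
  have : FiniteDimensional K V :=
    Module.finite_of_finrank_pos (zero_lt_two.trans hB.two_lt_finrank)
  have hker : ((B n).prod (B m)).ker ≠ ⊥ :=
    LinearMap.ker_ne_bot_of_finrank_lt (by simpa using hB.two_lt_finrank)
  obtain ⟨w, hw, hw0⟩ := Submodule.exists_mem_ne_zero_of_ne_bot hker
  obtain ⟨hnw, hmw⟩ : B n w = 0 ∧ B m w = 0 := by simpa using hw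
  refine ⟨w, hB.comm n w ▸ hnw, hB.comm m w ▸ hmw, fun hww => ?_⟩
  have hn0 : n ≠ 0 := by rintro rfl; simp at hmn
  obtain ⟨a, rfl⟩ := hB.collinear n w hn0 hn hww (hB.comm n w ▸ hnw)
  have ha : a = 0 := by simpa [hmn] using hmw
  exact hw0 (by rw [ha, zero_smul])

variable [NeZero (2 : K)]

theorem sub_null_iff (hB : IsLorentzian B) {u v : V} (hu : B u u = 0) (hv : B v v = 0) :
    B (u - v) (u - v) = 0 ↔ B u v = 0 := by
  rw [sub_eq_add_neg, hB.apply_add_self]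
  simp [hu, hv, two_ne_zero]

/-- If `B u n = 0`, then either all points of the line are null or none is. -/
theorem existsUnique_null_add_smul_iff (hB : IsLorentzian B) {n : V} (hn : B n n = 0) (u : V) :
    (∃! a : K, B (u + a • n) (u + a • n) = 0) ↔ B u n ≠ 0 := by
  simp only [hB.apply_add_smul_self hn]
  constructor
  · rintro ⟨a, ha, huniq⟩ hun
    simp only [hun, mul_zero, add_zero] at ha huniq
    exact one_ne_zero ((huniq 1 ha).trans (huniq 0 ha).symm)
  · intro hun
    refine ⟨-B u u / (2 * B u n), by field_simp; ring, fun a ha => ?_⟩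
    rw [eq_div_iff (mul_ne_zero two_ne_zero hun)]
    linear_combination ha

theorem exists_null_not_orthogonal (hB : IsLorentzian B) {n : V} (hn0 : n ≠ 0) (hn : B n n = 0) :
    ∃ m, B m m = 0 ∧ B m n ≠ 0 := by
  obtain ⟨v, hv⟩ : ∃ v, B v n ≠ 0 := by
    by_contra! h
    exact hn0 (hB.nondegenerate.2 n h)
  obtain ⟨a, ha, -⟩ := (hB.existsUnique_null_add_smul_iff hn v).2 hv
  exact ⟨v + a • n, ha, by simpa [hn] using hv⟩

theorem self_mem_span_null_not_orthogonal (hB : IsLorentzian B) {n : V} (hn0 : n ≠ 0)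
    (hn : B n n = 0) : n ∈ Submodule.span K {v | B v v = 0 ∧ B v n ≠ 0} := by
  obtain ⟨m, hm, hmn⟩ := hB.exists_null_not_orthogonal hn0 hn
  obtain ⟨w, hwn, hwm, hww⟩ := hB.exists_orthogonal_not_null hn hmn
  set S := Submodule.span K {v | B v v = 0 ∧ B v n ≠ 0}
  set a := -B w w / (2 * B m n) with ha
  have ha0 : a ≠ 0 := div_ne_zero (neg_ne_zero.2 hww) (mul_ne_zero two_ne_zero hmn)
  have mem_of_sq {s : K} (hs : s ^ 2 = 1) : m + s • w + a • n ∈ S := by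
    refine Submodule.subset_span ⟨?_, by simpa [hwn, hn] using hmn⟩
    rw [hB.apply_add_smul_self hn, hB.apply_add_self]
    simp only [map_add, map_smul, LinearMap.add_apply, LinearMap.smul_apply, smul_eq_mul, hm, hwn,
      hB.comm m w, hwm, ha]
    field_simp
    linear_combination B w w * B m n * hs
  have hsum : (m + (1 : K) • w + a • n) + (m + (-1 : K) • w + a • n) - (2 : K) • m
      = (2 * a) • n := by module
  rw [← S.smul_mem_iff (mul_ne_zero two_ne_zero ha0), ← hsum]
  exact S.sub_mem (S.add_mem (mem_of_sq (by ring)) (mem_of_sq (by ring)))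
    (S.smul_mem _ (Submodule.subset_span ⟨hm, hmn⟩))

theorem mem_span_null_not_orthogonal (hB : IsLorentzian B) {n : V} (hn0 : n ≠ 0)
    (hn : B n n = 0) (v : V) : v ∈ Submodule.span K {v | B v v = 0 ∧ B v n ≠ 0} := by
  have hnS := hB.self_mem_span_null_not_orthogonal hn0 hn
  obtain ⟨m, hm, hmn⟩ := hB.exists_null_not_orthogonal hn0 hn
  set S := Submodule.span K {v | B v v = 0 ∧ B v n ≠ 0}
  have mem_of_not_orthogonal {v : V} (hv : B v n ≠ 0) : v ∈ S := by
    obtain ⟨a, ha, -⟩ := (hB.existsUnique_null_add_smul_iff hn v).2 hv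
    rw [← S.add_mem_iff_left (S.smul_mem a hnS)]
    exact Submodule.subset_span ⟨ha, by simpa [hn] using hv⟩
  by_cases hv : B v n = 0
  · rw [← S.add_mem_iff_left (Submodule.subset_span ⟨hm, hmn⟩)]
    exact mem_of_not_orthogonal (by simpa [hv] using hmn)
  · exact mem_of_not_orthogonal hv

theorem eq_of_null_sub_iff (hB : IsLorentzian B) {x y : V}
    (h : ∀ z, B (x - z) (x - z) = 0 ↔ B (y - z) (y - z) = 0) : x = y := by
  by_contra hxy
  have hn : B (y - x) (y - x) = 0 := (h x).1 (by simp)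
  obtain ⟨m, hm, hmn⟩ := hB.exists_null_not_orthogonal (sub_ne_zero.2 (Ne.symm hxy)) hn
  have hm' := (h (x + m)).1 (by simp [hm])
  rw [← sub_sub, hB.sub_null_iff hn hm, hB.comm] at hm'
  exact hmn hm'

end IsLorentzian

end Lorentzian

section PreservesNull

variable {K K' V V' : Type*} [Field K] [Field K'] [AddCommGroup V] [Module K V]
  [AddCommGroup V'] [Module K' V'] {B : LinearMap.BilinForm K V} {B' : LinearMap.BilinForm K' V'}

/-- Preservation in both directions of null separation, the relation of two points whose difference
is a null vector. -/
def PreservesNull (B : LinearMap.BilinForm K V) (B' : LinearMap.BilinForm K' V') (f : V → V') :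
    Prop :=
  ∀ x y, B (x - y) (x - y) = 0 ↔ B' (f x - f y) (f x - f y) = 0

namespace PreservesNull

section Bijection

variable {f : V ≃ V'}

theorem symm (hf : PreservesNull B B' f) : PreservesNull B' B f.symm := fun x y => by
  simpa using (hf (f.symm x) (f.symm y)).symm

theorem null_map_add_sub (hf : PreservesNull B B' f) {n : V} (hn : B n n = 0) (x : V) :
    B' (f (x + n) - f x) (f (x + n) - f x) = 0 :=
  (hf _ _).1 (by simpa using hn)

variable [NeZero (2 : K')]

theorem exists_map_add_smul (hB' : IsLorentzian B') (hf : PreservesNull B B' f) {n : V}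
    (hn0 : n ≠ 0) (hn : B n n = 0) (x : V) (a : K) :
    ∃ b : K', f (x + a • n) = f x + b • (f (x + n) - f x) := by
  have hp0 : f (x + n) - f x ≠ 0 := sub_ne_zero.2 (f.injective.ne (by simpa using hn0))
  have hp := hf.null_map_add_sub hn x
  have hq := hf.null_map_add_sub (n := a • n) (by simp [hn]) x
  have hqp : B' (f (x + a • n) - f (x + n)) (f (x + a • n) - f (x + n)) = 0 := by
    rw [← hf, add_sub_add_left_eq_sub, show a • n - n = (a - 1) • n by module]
    simp [hn]
  rw [← sub_sub_sub_cancel_right _ _ (f x), hB'.sub_null_iff hq hp] at hqp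
  obtain ⟨b, hb⟩ := hB'.collinear _ _ hp0 hp hq hqp
  exact ⟨b, by rw [← hb, add_sub_cancel]⟩

variable [NeZero (2 : K)]

theorem exists_equiv_map_add_smul (hB : IsLorentzian B) (hB' : IsLorentzian B')
    (hf : PreservesNull B B' f) {n : V} (hn0 : n ≠ 0) (hn : B n n = 0) (x : V) :
    ∃ e : K ≃ K', ∀ a, f (x + a • n) = f x + e a • (f (x + n) - f x) := by
  have hp0 : f (x + n) - f x ≠ 0 := sub_ne_zero.2 (f.injective.ne (by simpa using hn0))
  choose e he using hf.exists_map_add_smul hB' hn0 hn x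
  refine ⟨Equiv.ofBijective e ⟨fun a b hab => ?_, fun b => ?_⟩, he⟩
  · have hfab : f (x + a • n) = f (x + b • n) := by rw [he, he, hab]
    exact smul_left_injective K hn0 (add_left_cancel (f.injective hfab))
  · obtain ⟨a, ha⟩ := hf.symm.exists_map_add_smul hB hp0 (hf.null_map_add_sub hn x) (f x) b
    rw [add_sub_cancel, f.symm_apply_apply, f.symm_apply_apply, add_sub_cancel_left,
      f.symm_apply_eq, he] at ha
    exact ⟨a, smul_left_injective K' hp0 (add_left_cancel ha).symm⟩

/-- The points of a null line that are null separated from `z` are counted on both sides. -/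
theorem orthogonal_iff (hB : IsLorentzian B) (hB' : IsLorentzian B') (hf : PreservesNull B B' f)
    {n : V} (hn : B n n = 0) (x z : V) :
    B (x - z) n = 0 ↔ B' (f x - f z) (f (x + n) - f x) = 0 := by
  rcases eq_or_ne n 0 with rfl | hn0
  · simp
  obtain ⟨e, he⟩ := hf.exists_equiv_map_add_smul hB hB' hn0 hn x
  rw [← not_iff_not, ← ne_eq, ← ne_eq, ← hB.existsUnique_null_add_smul_iff hn,
    ← hB'.existsUnique_null_add_smul_iff (hf.null_map_add_sub hn x)]
  refine e.existsUnique_congr fun a => ?_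
  rw [← add_sub_right_comm, ← add_sub_right_comm, ← he]
  exact hf _ _

theorem exists_map_add_sub_eq_smul (hB : IsLorentzian B) (hB' : IsLorentzian B')
    (hf : PreservesNull B B' f) {n : V} (hn0 : n ≠ 0) (hn : B n n = 0) (x y : V) :
    ∃ b : K', f (y + n) - f y = b • (f (x + n) - f x) := by
  have hp0 : f (x + n) - f x ≠ 0 := sub_ne_zero.2 (f.injective.ne (by simpa using hn0))
  obtain ⟨e, he⟩ := hf.exists_equiv_map_add_smul hB hB' hn0 hn x
  have hp := hf.null_map_add_sub hn x
  have hq := hf.null_map_add_sub hn y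
  set p := f (x + n) - f x
  set q := f (y + n) - f y
  -- The left-hand side does not depend on `b`, so the right-hand side holds for all `b`
  -- or for none.
  have hiff (b : K') : B (y - x) n = 0 ↔ B' (f y - f x) q - b * B' p q = 0 := by
    have h := hf.orthogonal_iff hB hB' hn y (x + e.symm b • n)
    rw [he, e.apply_symm_apply, ← sub_sub, ← sub_sub, LinearMap.map_sub₂ B, LinearMap.map_smul₂ B,
      hn, smul_zero, sub_zero, LinearMap.map_sub₂ B', LinearMap.map_smul₂ B'] at h
    exact h
  have hpq : B' p q = 0 := by
    by_contra hpq
    have h₀ := (hiff (B' (f y - f x) q / B' p q)).2 (by field_simp; ring)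
    have h₁ := (hiff (B' (f y - f x) q / B' p q + 1)).1 h₀
    simp [add_mul, hpq] at h₁
  exact hB'.collinear p q hp0 hp hq (hB'.comm p q ▸ hpq)

theorem map_add_add_sub_eq_of_not_orthogonal (hB : IsLorentzian B) (hB' : IsLorentzian B')
    (hf : PreservesNull B B' f) {n m : V} (hn : B n n = 0) (hm : B m m = 0) (hmn : B m n ≠ 0)
    (x : V) : f (x + m + n) - f (x + m) = f (x + n) - f x := by
  have hn0 : n ≠ 0 := by rintro rfl; simp at hmn
  have hm0 : m ≠ 0 := by rintro rfl; simp at hmn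
  obtain ⟨b, hb⟩ := hf.exists_map_add_sub_eq_smul hB hB' hn0 hn x (x + m)
  obtain ⟨c, hc⟩ := hf.exists_map_add_sub_eq_smul hB hB' hm0 hm x (x + n)
  rw [add_right_comm] at hc
  set p := f (x + n) - f x with hp
  set q := f (x + m) - f x with hq
  have hqq : B' q q = 0 := hf.null_map_add_sub hm x
  have hpq : B' p q ≠ 0 := by
    rw [ne_eq, ← hB'.sub_null_iff (hf.null_map_add_sub hn x) hqq, sub_sub_sub_cancel_right, ← hf,
      add_sub_add_left_eq_sub, hB.sub_null_iff hn hm, hB.comm]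
    exact hmn
  have hbc : b • p + q = c • q + p := by
    rw [← hb, ← hc, hp, hq]
    abel
  have hb1 : (b - 1) * B' p q = 0 := by
    have h := congrArg (fun v => B' v q) hbc
    simp only [LinearMap.map_add₂, LinearMap.map_smul₂, smul_eq_mul, hqq] at h
    linear_combination h
  rw [hb, sub_eq_zero.1 ((mul_eq_zero.1 hb1).resolve_right hpq), one_smul]

theorem map_add_add_sub_eq_of_null (hB : IsLorentzian B) (hB' : IsLorentzian B')
    (hf : PreservesNull B B' f) {n : V} (hn0 : n ≠ 0) (hn : B n n = 0) (x v : V) :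
    f (x + v + n) - f (x + v) = f (x + n) - f x := by
  have hv := hB.mem_span_null_not_orthogonal hn0 hn v
  induction hv using Submodule.closure_induction generalizing x with
  | zero => simp
  | add u v _ _ hu hv => rw [← add_assoc, hv, hu]
  | smul_mem a m hm =>
    rcases eq_or_ne a 0 with rfl | ha
    · simp
    · exact hf.map_add_add_sub_eq_of_not_orthogonal hB hB' hn (by simp [hm.1])
        (by simp [ha, hm.2]) x

theorem map_add_sub_eq (hB : IsLorentzian B) (hB' : IsLorentzian B')
    (hf : PreservesNull B B' f) (x v : V) : f (x + v) - f x = f v - f 0 := by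
  obtain ⟨n, hn0, hn⟩ := hB.exists_null
  have hv := hB.mem_span_null_not_orthogonal hn0 hn v
  induction hv using Submodule.closure_induction generalizing x with
  | zero => simp
  | add u v _ _ hu hv =>
    rw [← add_assoc, ← sub_add_sub_cancel _ (f (x + u)), hv, hu, ← hv u, sub_add_sub_cancel]
  | smul_mem a m hm =>
    rcases eq_or_ne (a • m) 0 with h0 | h0
    · simp [h0]
    · simpa using hf.map_add_add_sub_eq_of_null hB hB' h0 (by simp [hm.1]) 0 x

theorem exists_addEquiv (hB : IsLorentzian B) (hB' : IsLorentzian B')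
    (hf : PreservesNull B B' f) :
    ∃ g : V ≃+ V', PreservesNull B B' g ∧ ∀ x y, f x - f y = g (x - y) := by
  have hg (x y : V) : f x - f y = f (x - y) - f 0 := by
    simpa using hf.map_add_sub_eq hB hB' y (x - y)
  let g : V ≃+ V' :=
    { f.trans (Equiv.subRight (f 0)) with
      map_add' := fun x y => by
        change f (x + y) - f 0 = (f x - f 0) + (f y - f 0)
        rw [← hf.map_add_sub_eq hB hB' x y]
        abel }
  refine ⟨g, fun x y => ?_, hg⟩
  rw [hf, hg, ← map_sub g]
  rfl

end Bijection

end PreservesNull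

section Additive

/-- `ScalesBy g σ v`: the additive map `g` carries the line through `v` to the line through `g v`,
multiplying parameters by `σ`.  Nothing is assumed of `σ`, which is shown to be a ring homomorphism
only later. -/
def ScalesBy (g : V ≃+ V') (σ : K → K') (v : V) : Prop := ∀ t : K, g (t • v) = σ t • g v

variable {g : V ≃+ V'} {σ : K → K'}

theorem ScalesBy.add {u v : V} (hu : ScalesBy g σ u) (hv : ScalesBy g σ v) :
    ScalesBy g σ (u + v) := fun t => by
  rw [smul_add, map_add, map_add, smul_add, hu, hv]

theorem ScalesBy.smul {σ : K →+* K'} {v : V} (hv : ScalesBy g σ v) (a : K) :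
    ScalesBy g σ (a • v) := fun t => by
  rw [smul_smul, hv, hv, map_mul, mul_smul]

theorem PreservesNull.exists_scalesBy [NeZero (2 : K')] (hB' : IsLorentzian B')
    (hg : PreservesNull B B' g) {n : V} (hn0 : n ≠ 0) (hn : B n n = 0) :
    ∃ σ : K → K', ScalesBy g σ n := by
  choose σ hσ using exists_map_add_smul (f := g.toEquiv) hB' hg hn0 hn 0
  exact ⟨σ, fun t => by simpa using hσ t⟩

variable [NeZero (2 : K)] [NeZero (2 : K')]

namespace PreservesNull

theorem apply_eq_zero_iff (hB : IsLorentzian B) (hB' : IsLorentzian B') (hg : PreservesNull B B' g)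
    {n : V} (hn : B n n = 0) (v : V) : B v n = 0 ↔ B' (g v) (g n) = 0 := by
  simpa using orthogonal_iff (f := g.toEquiv) hB hB' hg hn v 0

theorem apply_eq_apply (hB : IsLorentzian B) (hB' : IsLorentzian B') (hg : PreservesNull B B' g)
    {n u v : V} (hn : B n n = 0) (huv : B u n = B v n) : B' (g u) (g n) = B' (g v) (g n) := by
  rw [← sub_eq_zero, ← LinearMap.sub_apply, ← map_sub, ← map_sub,
    ← hg.apply_eq_zero_iff hB hB' hn, map_sub, LinearMap.sub_apply, huv, sub_self]

end PreservesNull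

namespace ScalesBy

/-- The value of `g` on the line through `p` is read off by pairing it with the null vector `g n`,
which sees `t • p` and `t • v` alike. -/
theorem of_apply_eq (hB : IsLorentzian B) (hB' : IsLorentzian B')
    (hg : PreservesNull B B' g) {n v p : V} (hv : ScalesBy g σ v) (hn : B n n = 0)
    (hp : B p p = 0) (hpv : B p n = B v n) (hvn : B v n ≠ 0) : ScalesBy g σ p := by
  have hp0 : p ≠ 0 := by rintro rfl; simp [hvn.symm] at hpv
  obtain ⟨τ, hτ⟩ := hg.exists_scalesBy hB' hp0 hp
  have hgv : B' (g v) (g n) ≠ 0 := (hg.apply_eq_zero_iff hB hB' hn v).not.1 hvn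
  have hgp := hg.apply_eq_apply hB hB' hn hpv
  intro t
  have ht : B' (g (t • p)) (g n) = B' (g (t • v)) (g n) :=
    hg.apply_eq_apply hB hB' hn (by simp [hpv])
  rw [hτ, hv] at ht
  simp only [map_smul, LinearMap.smul_apply, smul_eq_mul, hgp] at ht
  rw [hτ, mul_right_cancel₀ hgv ht]

theorem of_orthogonal (hB : IsLorentzian B) (hB' : IsLorentzian B')
    (hg : PreservesNull B B' g) {m p w : V} (hm : ScalesBy g σ m) (hmm : B m m = 0)
    (hp : B p p = 0) (hmp : B m p ≠ 0) (hwm : B w m = 0) (hwp : B w p = 0)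
    (hww : B w w + 2 * B m p = 0) : ScalesBy g σ p := by
  have hq : B (m + w + p) (m + w + p) = 0 := by
    rw [hB.apply_add_self, hB.apply_add_self, hB.comm m w, map_add, LinearMap.add_apply]
    linear_combination hww + hmm + 2 * hwm + 2 * hwp + hp
  have hq_scales : ScalesBy g σ (m + w + p) :=
    hm.of_apply_eq hB hB' hg hp hq (by simp [hwp, hp]) hmp
  refine hq_scales.of_apply_eq hB hB' hg hmm hp (by simp [hmm, hwm]) ?_
  simpa [hmm, hwm, hB.comm p m] using hmp

end ScalesBy

namespace PreservesNull

/-- Both `p` and `s ^ 2 • p` complete the same multiple of a null vector `m` and a vector `w`,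
respectively `s • w`, orthogonal to `m` and `p` to a null vector. -/
theorem exists_scalesBy_smul_iff (hB : IsLorentzian B) (hB' : IsLorentzian B')
    (hg : PreservesNull B B' g) {p m : V} (hp : B p p = 0) (hm : B m m = 0) (hmp : B m p ≠ 0) :
    ∃ c : K, c ≠ 0 ∧ ∀ s : K, s ≠ 0 → ∀ σ : K → K',
      ScalesBy g σ (c • m) ↔ ScalesBy g σ (s ^ 2 • p) := by
  obtain ⟨w, hwp, hwm, hww⟩ := hB.exists_orthogonal_not_null hp hmp
  set c := -B w w / (2 * B m p) with hc
  have hc0 : c ≠ 0 := div_ne_zero (neg_ne_zero.2 hww) (mul_ne_zero two_ne_zero hmp)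
  refine ⟨c, hc0, fun s hs σ => ⟨fun h => ?_, fun h => ?_⟩⟩
  · refine h.of_orthogonal hB hB' hg (w := s • w) (by simp [hm]) (by simp [hp])
      (by simp [hc0, hs, hmp]) (by simp [hwm]) (by simp [hwp]) ?_
    simp only [map_smul, LinearMap.smul_apply, smul_eq_mul, hc]
    field_simp
    ring
  · refine h.of_orthogonal hB hB' hg (w := s • w) (by simp [hp]) (by simp [hm])
      (by simp [hc0, hs, hB.comm p m, hmp]) (by simp [hwp]) (by simp [hwm]) ?_
    simp only [map_smul, LinearMap.smul_apply, smul_eq_mul, hc, hB.comm p m]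
    field_simp
    ring

theorem scalesBy_sq_smul (hB : IsLorentzian B) (hB' : IsLorentzian B') (hg : PreservesNull B B' g)
    {p : V} (hp0 : p ≠ 0) (hp : B p p = 0) (hσ : ScalesBy g σ p) {s : K} (hs : s ≠ 0) :
    ScalesBy g σ (s ^ 2 • p) := by
  obtain ⟨m, hm, hmp⟩ := hB.exists_null_not_orthogonal hp0 hp
  obtain ⟨c, -, hc⟩ := hg.exists_scalesBy_smul_iff hB hB' hp hm hmp
  rw [← hc s hs, hc 1 one_ne_zero, one_pow, one_smul]
  exact hσ

theorem exists_ringHom_scalesBy (hB : IsLorentzian B) (hB' : IsLorentzian B')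
    (hg : PreservesNull B B' g) {p : V} (hp0 : p ≠ 0) (hp : B p p = 0) :
    ∃ σ : K →+* K', ScalesBy g σ p := by
  obtain ⟨σ, hσ⟩ := hg.exists_scalesBy hB' hp0 hp
  have smul_cancel {a b : K'} (h : a • g p = b • g p) : a = b :=
    smul_left_injective K' ((map_ne_zero_iff g g.injective).2 hp0) h
  obtain ⟨τ, hτ⟩ : ∃ τ : K →+ K', ScalesBy g τ p :=
    ⟨AddMonoidHom.mk' σ fun a b => smul_cancel (by rw [← hσ, add_smul, map_add, hσ, hσ, add_smul]),
      hσ⟩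
  have map_one : τ 1 = 1 := smul_cancel (by rw [one_smul, ← hτ, one_smul])
  have map_mul_sq (t s : K) : τ (t * s ^ 2) = τ t * τ (s ^ 2) := by
    rcases eq_or_ne s 0 with rfl | hs
    · simp
    · refine smul_cancel ?_
      rw [← hτ, mul_smul, hg.scalesBy_sq_smul hB hB' hp0 hp hτ hs t, hτ, mul_smul]
  have map_mul (a b : K) : τ (a * b) = τ a * τ b := by
    have hb : b = ((b + 1) / 2) ^ 2 - ((b - 1) / 2) ^ 2 := by field_simp; ring
    rw [hb, mul_sub, map_sub, map_sub, map_mul_sq, map_mul_sq, mul_sub]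
  exact ⟨{ τ with map_one' := map_one, map_mul' := map_mul }, hτ⟩

theorem exists_ringHom_forall_scalesBy (hB : IsLorentzian B) (hB' : IsLorentzian B')
    (hg : PreservesNull B B' g) : ∃ σ : K →+* K', ∀ v, ScalesBy g σ v := by
  obtain ⟨n, hn0, hn⟩ := hB.exists_null
  obtain ⟨σ, hσ⟩ := hg.exists_ringHom_scalesBy hB hB' hn0 hn
  refine ⟨σ, fun v => ?_⟩
  have hv := hB.mem_span_null_not_orthogonal hn0 hn v
  induction hv using Submodule.span_induction with
  | mem m hm =>
    obtain ⟨c, hc0, hc⟩ := hg.exists_scalesBy_smul_iff hB hB' hn hm.1 hm.2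
    have hcm : ScalesBy g σ (c • m) := (hc 1 one_ne_zero σ).2 (by simpa using hσ)
    simpa [smul_smul, hc0] using hcm.smul c⁻¹
  | zero => exact fun t => by simp
  | add u v _ _ hu hv => exact hu.add hv
  | smul a v _ hv => exact hv.smul a

theorem exists_apply_map_eq_mul (hB : IsLorentzian B) (hB' : IsLorentzian B')
    (hg : PreservesNull B B' g) {σ : K →+* K'} (hσ : ∀ v, ScalesBy g σ v) {n : V} (hn0 : n ≠ 0)
    (hn : B n n = 0) : ∃ l : K', ∀ v, B' (g v) (g n) = l * σ (B v n) := by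
  obtain ⟨m, -, hmn⟩ := hB.exists_null_not_orthogonal hn0 hn
  refine ⟨B' (g m) (g n) / σ (B m n), fun v => ?_⟩
  rw [hg.apply_eq_apply hB hB' hn (u := v) (v := (B v n / B m n) • m) (by simp [hmn]), hσ,
    LinearMap.map_smul₂, smul_eq_mul, map_div₀]
  ring

theorem exists_similarity_factor (hB : IsLorentzian B) (hB' : IsLorentzian B')
    (hg : PreservesNull B B' g) {σ : K →+* K'} (hσ : ∀ v, ScalesBy g σ v) :
    ∃ l : K', l ≠ 0 ∧ ∀ x y, B' (g x) (g y) = l * σ (B x y) := by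
  obtain ⟨n, hn0, hn⟩ := hB.exists_null
  obtain ⟨l, hl⟩ := hg.exists_apply_map_eq_mul hB hB' hσ hn0 hn
  obtain ⟨m, -, hmn⟩ := hB.exists_null_not_orthogonal hn0 hn
  have hl0 : l ≠ 0 := by
    rintro rfl
    exact hmn ((hg.apply_eq_zero_iff hB hB' hn m).2 (by simp [hl]))
  refine ⟨l, hl0, fun x y => ?_⟩
  have hy := hB.mem_span_null_not_orthogonal hn0 hn y
  induction hy using Submodule.span_induction with
  | mem p hp =>
    obtain ⟨hpp, hpn⟩ := hp
    obtain ⟨l', hl'⟩ := hg.exists_apply_map_eq_mul hB hB' hσ (by rintro rfl; simp at hpn) hpp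
    have hll' : l' * σ (B p n) = l * σ (B p n) := by rw [← hl, hB'.comm, hl', hB.comm]
    rw [hl', mul_right_cancel₀ ((map_ne_zero σ).2 hpn) hll']
  | zero => simp
  | add u v _ _ hu hv => simp only [map_add, mul_add, hu, hv]
  | smul a v _ hv => simp only [hσ _ a, map_smul, smul_eq_mul, map_mul, hv, mul_left_comm]

end PreservesNull

end Additive

/-- The Alexandrov–Zeeman theorem over arbitrary fields of characteristic other than two. -/
theorem PreservesNull.exists_semilinear [NeZero (2 : K)] [NeZero (2 : K')] {f : V ≃ V'}
    (hB : IsLorentzian B) (hB' : IsLorentzian B') (hf : PreservesNull B B' f) :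
    ∃ (σ : K →+* K') (g : V →ₛₗ[σ] V') (l : K'), l ≠ 0 ∧ (∀ x y, f x - f y = g (x - y)) ∧
      ∀ x y, B' (g x) (g y) = l * σ (B x y) := by
  obtain ⟨g, hg, hfg⟩ := hf.exists_addEquiv hB hB'
  obtain ⟨σ, hσ⟩ := hg.exists_ringHom_forall_scalesBy hB hB'
  obtain ⟨l, hl0, hl⟩ := hg.exists_similarity_factor hB hB' hσ
  exact ⟨σ, { g with map_smul' := fun t v => hσ v t }, l, hl0, hfg, hl⟩

end PreservesNull

section Minkowski

open WorldviewModel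

variable {Q : Type*} [Field Q] {d : ℕ} [NeZero d]

/-- The Minkowski form of signature `(1, d - 1)` for which `c` is the speed of light; as in `time`,
coordinate `0` is the time coordinate. -/
def minkowski (c : Q) : LinearMap.BilinForm Q (Fin d → Q) :=
  Matrix.toBilin' (Matrix.diagonal fun i => if i = 0 then c ^ 2 else -1)

theorem minkowski_apply (c : Q) (x y : Fin d → Q) :
    minkowski c x y = c ^ 2 * (x 0 * y 0) - ∑ i ∈ Finset.univ.erase 0, x i * y i := by
  rw [minkowski, Matrix.toBilin'_apply', dotProduct,
    ← Finset.add_sum_erase _ _ (Finset.mem_univ (0 : Fin d)), sub_eq_add_neg,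
    ← Finset.sum_neg_distrib]
  simp only [Matrix.mulVec_diagonal, if_true]
  congr 1
  · ring
  · exact Finset.sum_congr rfl fun i hi => by rw [if_neg (Finset.ne_of_mem_erase hi)]; ring

theorem minkowski_sub_self (c : Q) (x y : Fin d → Q) :
    minkowski c (x - y) (x - y) = c ^ 2 * time x y ^ 2 - spaceSq x y := by
  simp only [minkowski_apply, time, spaceSq, sq, Pi.sub_apply]

theorem minkowski_timeUnit (c : Q) (x : Fin d → Q) : minkowski c x timeUnit = c ^ 2 * x 0 := by
  rw [minkowski_apply, Finset.sum_eq_zero fun i hi => ?_]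
  · simp [timeUnit]
  · simp [timeUnit, Finset.ne_of_mem_erase hi]

theorem minkowski_eq_zero_iff_euclOrthogonal (c : Q) {x : Fin d → Q} (hx : x 0 = 0)
    (y : Fin d → Q) : minkowski c x y = 0 ↔ EuclOrthogonal x y := by
  rw [minkowski_apply, EuclOrthogonal, ← Finset.add_sum_erase _ _ (Finset.mem_univ 0), hx,
    zero_mul, mul_zero, zero_sub, zero_add, neg_eq_zero]

theorem exists_null_minkowski (hd : 2 ≤ d) (c : Q) :
    ∃ n : Fin d → Q, n ≠ 0 ∧ minkowski c n n = 0 := by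
  have : Nontrivial (Fin d) := Fin.nontrivial_iff_two_le.2 hd
  obtain ⟨i, hi⟩ := exists_ne (0 : Fin d)
  refine ⟨timeUnit + Pi.single i c, fun h => ?_, ?_⟩
  · simpa [timeUnit, hi.symm] using congrFun h 0
  · have hsum : ∑ j ∈ Finset.univ.erase (0 : Fin d), (timeUnit + Pi.single i c : Fin d → Q) j *
        (timeUnit + Pi.single i c : Fin d → Q) j = c * c := by
      rw [Finset.sum_eq_single i]
      · simp [timeUnit, hi]
      · intro j hj hji
        simp [timeUnit, Finset.ne_of_mem_erase hj, hji]
      · simp [hi]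
    rw [minkowski_apply, hsum]
    simp [timeUnit, hi.symm, sq]

theorem eq_smul_timeUnit {x : Fin d → Q} (hx : ∀ i, i ≠ 0 → x i = 0) : x = x 0 • timeUnit := by
  ext i
  rcases eq_or_ne i 0 with rfl | hi
  · simp [timeUnit]
  · simp [timeUnit, hi, hx i hi]

variable [LinearOrder Q] [IsStrictOrderedRing Q]

theorem sub_eq_smul_timeUnit_of_spaceSq_eq_zero {x y : Fin d → Q} (h : spaceSq x y = 0) :
    x - y = time x y • timeUnit := by
  rw [spaceSq, Finset.sum_eq_zero_iff_of_nonneg fun i _ => sq_nonneg _] at h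
  exact eq_smul_timeUnit fun i hi =>
    pow_eq_zero_iff two_ne_zero |>.1 (h i (Finset.mem_erase.2 ⟨hi, Finset.mem_univ i⟩))

theorem eq_zero_of_minkowski_self {c : Q} {x : Fin d → Q} (hx : minkowski c x x = 0)
    (h0 : x 0 = 0) : x = 0 := by
  have ht : time x 0 = 0 := by simpa [time] using h0
  have hs : spaceSq x 0 = 0 := by simpa [hx, ht] using minkowski_sub_self c x 0
  simpa [ht] using sub_eq_smul_timeUnit_of_spaceSq_eq_zero hs

theorem isLorentzian_minkowski (hd : 3 ≤ d) {c : Q} (hc : c ≠ 0) :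
    IsLorentzian (minkowski c : LinearMap.BilinForm Q (Fin d → Q)) where
  isSymm := ⟨fun x y => by simp [minkowski_apply, mul_comm]⟩
  nondegenerate := by
    refine LinearMap.BilinForm.nondegenerate_toBilin'_of_det_ne_zero' _ ?_
    rw [Matrix.det_diagonal, Finset.prod_ne_zero_iff]
    intro i _
    split_ifs
    · exact pow_ne_zero 2 hc
    · exact neg_ne_zero.2 one_ne_zero
  two_lt_finrank := by rwa [Module.finrank_fin_fun]
  exists_null := exists_null_minkowski (by omega) c
  collinear n v hn0 hn hv hvn := by
    have hn₀ : n 0 ≠ 0 := fun h => hn0 (eq_zero_of_minkowski_self hn h)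
    have hnv : minkowski c n v = 0 := by rw [← hvn]; simp [minkowski_apply, mul_comm]
    refine ⟨v 0 / n 0, sub_eq_zero.1 (eq_zero_of_minkowski_self (c := c) ?_ ?_)⟩
    · simp [hn, hv, hnv, hvn]
    · simp [hn₀]

section NullPreserving

variable {c c' : Q} {f : (Fin d → Q) ≃ (Fin d → Q)}

theorem minkowski_map_sub_eq_zero_iff (hd : 3 ≤ d) (hc : c ≠ 0) (hc' : c' ≠ 0)
    (hf : PreservesNull (minkowski c) (minkowski c') f) (x y : Fin d → Q) :
    minkowski c' (f x - f y) (f timeUnit - f 0) = 0 ↔ x 0 = y 0 := by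
  obtain ⟨σ, g, l, hl0, hfg, hl⟩ :=
    hf.exists_semilinear (isLorentzian_minkowski hd hc) (isLorentzian_minkowski hd hc')
  rw [hfg, hfg, hl, sub_zero, minkowski_timeUnit]
  simp [hl0, hc, sub_eq_zero, σ.injective.eq_iff]

theorem exists_map_sub_eq_smul (hd : 3 ≤ d) (hc : c ≠ 0) (hc' : c' ≠ 0)
    (hf : PreservesNull (minkowski c) (minkowski c') f) {x y : Fin d → Q} {t : Q}
    (hxy : x - y = t • timeUnit) : ∃ s : Q, f x - f y = s • (f timeUnit - f 0) := by
  obtain ⟨σ, g, -, -, hfg, -⟩ :=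
    hf.exists_semilinear (isLorentzian_minkowski hd hc) (isLorentzian_minkowski hd hc')
  exact ⟨σ t, by rw [hfg, hfg, sub_zero, hxy, map_smulₛₗ]⟩

end NullPreserving

end Minkowski

namespace WorldviewModel

variable {B Q : Type*} {d : ℕ} {M : WorldviewModel B Q d} {m k : B}

theorem AxEv.exists_ev_eq (hEv : M.AxEv) (hm : M.IOb m) (hk : M.IOb k) (x : Fin d → Q) :
    ∃ y, M.ev m x = M.ev k y :=
  (hEv m k hm hk x).imp fun _ h => Set.ext h

variable [NeZero d]

theorem simultaneous_ev_iff (hm : Function.Injective (M.ev m)) (x y : Fin d → Q) :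
    M.Simultaneous m (M.ev m x) (M.ev m y) ↔ x 0 = y 0 := by
  refine ⟨fun h => h x y rfl rfl, fun h x' y' hx hy => ?_⟩
  rw [← hm hx, ← hm hy, h]

variable [Field Q] [LinearOrder Q] {cm ck : Q}

/-- `M.HasLightSpeed m c`: according to `m`, light moves with speed `c` everywhere and in every
direction.  This is what `AxPh` asserts of every inertial observer for some `c`. -/
def HasLightSpeed (M : WorldviewModel B Q d) (m : B) (c : Q) : Prop :=
  0 < c ∧ ∀ x y : Fin d → Q,
    (∃ p, M.Ph p ∧ M.W m p x ∧ M.W m p y) ↔ spaceSq x y = c ^ 2 * time x y ^ 2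

theorem HasLightSpeed.minkowski_sub_self_eq_zero_iff (hm : M.HasLightSpeed m cm)
    (x y : Fin d → Q) :
    minkowski cm (x - y) (x - y) = 0 ↔ ∃ p, M.Ph p ∧ p ∈ M.ev m x ∧ p ∈ M.ev m y := by
  rw [minkowski_sub_self, sub_eq_zero, eq_comm]
  exact (hm.2 x y).symm

theorem HasLightSpeed.ev_nonempty (hm : M.HasLightSpeed m cm) (x : Fin d → Q) :
    (M.ev m x).Nonempty := by
  obtain ⟨p, -, hp, -⟩ := (hm.minkowski_sub_self_eq_zero_iff x x).1 (by simp)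
  exact ⟨p, hp⟩

theorem preservesNull_of_ev_eq (hm : M.HasLightSpeed m cm) (hk : M.HasLightSpeed k ck)
    {f : (Fin d → Q) → (Fin d → Q)} (hf : ∀ x, M.ev k x = M.ev m (f x)) :
    PreservesNull (minkowski ck) (minkowski cm) f := fun x y => by
  rw [hm.minkowski_sub_self_eq_zero_iff, hk.minkowski_sub_self_eq_zero_iff, hf, hf]

variable [IsStrictOrderedRing Q]

theorem HasLightSpeed.ev_injective (hd : 3 ≤ d) (hm : M.HasLightSpeed m cm) :
    Function.Injective (M.ev m) := fun x y hxy =>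
  (isLorentzian_minkowski hd hm.1.ne').eq_of_null_sub_iff fun z => by
    rw [hm.minkowski_sub_self_eq_zero_iff, hm.minkowski_sub_self_eq_zero_iff, hxy]

theorem exists_worldview_equiv (hd : 3 ≤ d) (hEv : M.AxEv) (hmI : M.IOb m) (hkI : M.IOb k)
    (hm : M.HasLightSpeed m cm) (hk : M.HasLightSpeed k ck) :
    ∃ f : (Fin d → Q) ≃ (Fin d → Q), ∀ x, M.ev k x = M.ev m (f x) := by
  choose f hf using hEv.exists_ev_eq hkI hmI
  choose g hg using hEv.exists_ev_eq hmI hkI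
  exact ⟨⟨f, g, fun x => hk.ev_injective hd (by rw [← hg, ← hf]),
    fun x => hm.ev_injective hd (by rw [← hf, ← hg])⟩, hf⟩

section Transformation

variable {f : (Fin d → Q) ≃ (Fin d → Q)}

theorem worldview_iff (hd : 3 ≤ d) (hm : M.HasLightSpeed m cm)
    (hf : ∀ x, M.ev k x = M.ev m (f x)) (x y : Fin d → Q) : M.worldview k m x y ↔ y = f x := by
  refine ⟨fun h => hm.ev_injective hd (h.1.symm.trans (hf x)), ?_⟩
  rintro rfl
  exact ⟨hf x, hf x ▸ hm.ev_nonempty (f x)⟩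

theorem separatedOrthogonally_iff (hd : 3 ≤ d) (hm : M.HasLightSpeed m cm)
    (hf : ∀ x, M.ev k x = M.ev m (f x)) (x y : Fin d → Q) : M.SeparatedOrthogonally m k x y ↔
      x 0 = y 0 ∧ EuclOrthogonal (x - y) (f timeUnit - f 0) := by
  simp [SeparatedOrthogonally, worldview_iff hd hm hf]

theorem simultaneous_ev_iff_minkowski (hd : 3 ≤ d) (hm : M.HasLightSpeed m cm)
    (hk : M.HasLightSpeed k ck) (hf : ∀ x, M.ev k x = M.ev m (f x)) (x y : Fin d → Q) :
    M.Simultaneous k (M.ev m x) (M.ev m y) ↔ minkowski cm (x - y) (f timeUnit - f 0) = 0 := by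
  obtain ⟨a, rfl⟩ := f.surjective x
  obtain ⟨b, rfl⟩ := f.surjective y
  rw [← hf, ← hf, simultaneous_ev_iff (hk.ev_injective hd),
    minkowski_map_sub_eq_zero_iff hd hk.1.ne' hm.1.ne' (preservesNull_of_ev_eq hm hk hf)]

theorem exists_map_timeUnit_sub_eq_smul (hd : 3 ≤ d) (hm : M.HasLightSpeed m cm)
    (hk : M.HasLightSpeed k ck) (hf : ∀ x, M.ev k x = M.ev m (f x))
    (hself : ∀ x : Fin d → Q, M.W k k x → ∀ i, i ≠ 0 → x i = 0) (hspeed : M.SpeedSq m k 0) :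
    ∃ s : Q, s ≠ 0 ∧ f timeUnit - f 0 = s • timeUnit := by
  obtain ⟨p, q, hpq, hp, hq, hspace⟩ := hspeed
  obtain ⟨a, rfl⟩ := f.surjective p
  obtain ⟨b, rfl⟩ := f.surjective q
  have on_axis {a : Fin d → Q} (ha : M.W m k (f a)) : ∀ i, i ≠ 0 → a i = 0 :=
    hself a ((Set.ext_iff.1 (hf a) k).2 ha)
  have hab : a - b = (a - b) 0 • timeUnit :=
    eq_smul_timeUnit fun i hi => by simp [on_axis hp i hi, on_axis hq i hi]
  have hnull := preservesNull_of_ev_eq hm hk hf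
  obtain ⟨t, ht⟩ := exists_map_sub_eq_smul hd hk.1.ne' hm.1.ne' hnull hab
  have htime := sub_eq_smul_timeUnit_of_spaceSq_eq_zero (hspace.trans (zero_mul _))
  have ht0 : t ≠ 0 := by rintro rfl; exact hpq (sub_eq_zero.1 (by simpa using ht))
  have htime0 : time (f a) (f b) ≠ 0 := fun h => hpq (sub_eq_zero.1 (by simpa [h] using htime))
  refine ⟨t⁻¹ * time (f a) (f b), mul_ne_zero (inv_ne_zero ht0) htime0, ?_⟩
  rw [mul_smul, ← htime, ht, inv_smul_smul₀ ht0]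

end Transformation

end WorldviewModel

open WorldviewModel in
theorem theorem7p14 {B Q : Type*} [Field Q] [LinearOrder Q] [IsStrictOrderedRing Q]
    {d : ℕ} [NeZero d] (hd : 3 ≤ d) (M : WorldviewModel B Q d) (hPh : M.AxPh) (hEv : M.AxEv)
    (m k : B) (hm : M.IOb m) (hk : M.IOb k) :
    (∀ x y : Fin d → Q,
      (M.Simultaneous m (M.ev m x) (M.ev m y) ∧ M.Simultaneous k (M.ev m x) (M.ev m y)) ↔
        M.SeparatedOrthogonally m k x y) ∧
    (M.AxSelf → M.SpeedSq m k 0 → ∀ x y : Fin d → Q,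
      M.Simultaneous m (M.ev m x) (M.ev m y) ↔ M.Simultaneous k (M.ev m x) (M.ev m y)) := by
  obtain ⟨cm, hcm⟩ : ∃ c, M.HasLightSpeed m c := hPh m hm
  obtain ⟨ck, hck⟩ : ∃ c, M.HasLightSpeed k c := hPh k hk
  obtain ⟨f, hf⟩ := exists_worldview_equiv hd hEv hm hk hcm hck
  have sim_m := simultaneous_ev_iff (hcm.ev_injective hd)
  have sim_k := simultaneous_ev_iff_minkowski hd hcm hck hf
  refine ⟨fun x y => ?_, fun hself hspeed x y => ?_⟩
  · rw [sim_m, sim_k, separatedOrthogonally_iff hd hcm hf]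
    exact and_congr_right fun hxy =>
      minkowski_eq_zero_iff_euclOrthogonal cm (sub_eq_zero.2 hxy) _
  · obtain ⟨s, hs0, hs⟩ :=
      exists_map_timeUnit_sub_eq_smul hd hcm hck hf (fun x => (hself k hk x).1) hspeed
    rw [sim_m, sim_k, hs, map_smul, minkowski_timeUnit]
    simp [hs0, hcm.1.ne', sub_eq_zero]
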